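/- **Setting.** Around a point $a$ of the plane let $C_0^a,\dots,C_4^a$ be the five cones with apex $a$ and angle $2\pi/5$, numbered clockwise, the bisector of $C_0^a$ being the upward vertical ray; the common boundary ray of two cones belongs to the counterclockwise one of the two. For a finite point set $P\subset\mathbb{R}^2$ in general position (no two points of $P$ lie on a line parallel or perpendicular to a cone boundary), the $\Theta_5$-graph of $P$ is the undirected graph with vertex set $P$ in which each $a\in P$ is joined, in each cone $C_i^a$ that contains a point of $P$, to the point of $P\cap C_i^a$ whose orthogonal projection on the bisector of $C_i^a$ is closest to $a$. Edges are weighted by Euclidean length. A graph on $P$ is a $t$-spanner if for all $a,b\in P$ the length of a shortest path from $a$ to $b$ is at most $t\,|ab|$. The spanning ratio of the $\Theta_5$-graph is the least $t\in[0,\infty]$ such that the $\Theta_5$-graph of every finite point set in general position is a $t$-spanner. For $b\in C_i^a$ the canonical triangle $T_{ab}$ is the triangle bounded by $C_i^a$ and the line through $b$ perpendicular to the bisector of $C_i^a$; its clockwise (cw) and counterclockwise (ccw) corners are the two corners different from $a$, on the cw and the ccw boundary ray of $C_i^a$. **Theorem.** The $\Theta_5$-graph has spanning ratio at least $\frac12(11\sqrt5-17)\approx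 3.798$. Moreover, for every $\delta>0$ there is a set of 31 points $v_1,\dots,v_{31}$ in general position, with the following properties. In its $\Theta_5$-graph the path $v_1v_{23}v_{10}v_6v_4v_2$ exists and is a shortest path between $v_1$ and $v_2$, and its length lies between $\left(\frac12(11\sqrt5-17)-\delta\right)|v_1v_2|$ and $\left(\frac12(11\sqrt5-17)+\delta\right)|v_1v_2|$. The points are placed as follows, where "close" means at distance less than $\delta|v_1v_2|$, and "$x$ at the cw (ccw) corner of $T_{ab}$" means that $x$ is in the interior of $T_{ab}$ and close to that corner: 1. $v_1$ is arbitrary; 2. $v_2\in C_0^{v_1}$ is close to the cw (top right) corner of $T_{v_1v_2}$; 3. $v_3$ at the ccw corner of $T_{v_1v_2}$, $v_4$ at the ccw corner of $T_{v_2v_1}$; 4. $v_5$ at the cw corner of $T_{v_1v_4}$, $v_6$ at the ccw corner of $T_{v_4v_1}$; 5. $v_7$ at the cw corner of $T_{v_2v_3}$, $v_8$ at the ccw corner of $T_{v_3v_2}$; 6. $v_9$ at the cw corner of $T_{v_1v_6}$, $v_{10}$ at the ccw corner of $T_{v_6v_1}$; 7. $v_{11}$ at the ccw corner of $T_{v_4v_5}$,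 $v_{12}$ at the cw corner of $T_{v_5v_4}$; 8. $v_{13}$ at the ccw corner of $T_{v_5v_6}$, $v_{14}$ at the cw corner of $T_{v_6v_5}$; 9. $v_{15}$ at the ccw corner of $T_{v_5v_{14}}$, $v_{16}$ at the cw corner of $T_{v_{14}v_5}$; 10. $v_{17}$ at the cw corner of $T_{v_6v_{13}}$, $v_{18}$ at the ccw corner of $T_{v_{13}v_6}$; 11. $v_{19}$ in the interiors of both $T_{v_2v_8}$ and $T_{v_8v_2}$, close to the intersection point of the cw boundary ray of the cone of $v_2$ containing $v_8$ and the ccw boundary ray of the cone of $v_8$ containing $v_2$; 12. $v_{20}$ at the ccw corner of $T_{v_3v_7}$, $v_{21}$ at the cw corner of $T_{v_7v_3}$; 13. $v_{22}$ at the ccw corner of $T_{v_2v_{12}}$; 14. $v_{23}$ in the interiors of both $T_{v_1v_{10}}$ and $T_{v_{10}v_1}$, close to the top (ccw) boundary ray of $C_1^{v_{10}}$, and such that $v_1$ lies in $C_1^{v_{23}}$, close to its bottom (cw) boundary ray; 15. $v_{24}$ at the ccw corner of $T_{v_4v_{12}}$, $v_{25}$ at the cw corner of $T_{v_{12}v_4}$;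 16. $v_{26}$ at the cw corner of $T_{v_{13}v_{14}}$, $v_{27}$ at the ccw corner of $T_{v_{14}v_{13}}$; 17. $v_{28}$ at the cw corner of $T_{v_9v_{18}}$, $v_{29}$ at the ccw corner of $T_{v_{18}v_9}$; 18. $v_{30}$ at the ccw corner of $T_{v_{11}v_{16}}$, $v_{31}$ at the cw corner of $T_{v_{16}v_{11}}$. -/

import Mathlib

open scoped ENNReal

noncomputable section

namespace Theta5

/-- The Euclidean plane. -/
abbrev Plane := EuclideanSpace ℝ (Fin 2)

/-- The unit vector at angle `φ`, measured counterclockwise from the positive `x`-axis. -/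
def unitVec (φ : ℝ) : Plane := !₂[Real.cos φ, Real.sin φ]

/-- The cones are numbered `0, …, 4` clockwise; the bisector of cone `0` is the positive
`y`-axis, and consecutive bisectors are `2π/5` apart. -/
def bisectorAngle (i : Fin 5) : ℝ := Real.pi / 2 - (i : ℕ) * (2 * Real.pi / 5)

/-- Unit vector along the bisector of cone `i`. -/
def bisector (i : Fin 5) : Plane := unitVec (bisectorAngle i)

/-- Unit vector along the clockwise boundary ray of cone `i`. -/
def cwSide (i : Fin 5) : Plane := unitVec (bisectorAngle i - Real.pi / 5)

/-- Unit vector along the counterclockwise boundary ray of cone `i`. -/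
def ccwSide (i : Fin 5) : Plane := unitVec (bisectorAngle i + Real.pi / 5)

/-- The determinant of two plane vectors; positive iff `y` is obtained from the direction of `x`
by a counterclockwise turn of less than `π`. -/
def cross (x y : Plane) : ℝ := x 0 * y 1 - x 1 * y 0

/-- `b` lies in cone `i` with apex `a`. The cone contains its clockwise boundary ray (without
the apex) and not its counterclockwise one: the common boundary of two cones belongs to the
counterclockwise one of the two. -/
def InCone (i : Fin 5) (a b : Plane) : Prop :=
  0 ≤ cross (cwSide i) (b - a) ∧ 0 < cross (b - a) (ccwSide i)

/-- Signed distance from `a` to the orthogonal projection of `b` on the bisector of the cone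
`i` with apex `a`. -/
def height (i : Fin 5) (a b : Plane) : ℝ := inner ℝ (bisector i) (b - a)

/-- `b` is a closest point of `P` to `a` in cone `i`: its projection on the bisector is closest
to `a`. -/
def IsClosestInCone (P : Finset Plane) (i : Fin 5) (a b : Plane) : Prop :=
  b ∈ P ∧ InCone i a b ∧ ∀ c ∈ P, InCone i a c → height i a b ≤ height i a c

/-- The (undirected) `Θ₅`-graph of a finite point set: every point is joined to the closest
point in each of its five cones. -/
def thetaGraph (P : Finset Plane) : SimpleGraph P :=
  SimpleGraph.fromRel fun a b => ∃ i, IsClosestInCone P i a b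

/-- General position: no two points of `P` lie on a line that is parallel or perpendicular to a
cone boundary. (Each boundary direction is `cwSide i` for some `i`.) -/
def GeneralPosition (P : Finset Plane) : Prop :=
  ∀ a ∈ P, ∀ b ∈ P, a ≠ b → ∀ i : Fin 5,
    cross (cwSide i) (b - a) ≠ 0 ∧ inner ℝ (cwSide i) (b - a) ≠ 0

/-- The total Euclidean length of a walk. -/
def walkLength {P : Finset Plane} {G : SimpleGraph P} {a b : P} (w : G.Walk a b) : ℝ≥0∞ :=
  (w.darts.map fun d => edist (d.fst : Plane) (d.snd : Plane)).sum

/-- The length of a shortest path from `a` to `b` (`∞` if there is none). -/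
def graphDist {P : Finset Plane} (G : SimpleGraph P) (a b : P) : ℝ≥0∞ :=
  ⨅ w : G.Walk a b, walkLength w

/-- `G` is a geometric `t`-spanner of `P`. -/
def IsGeomSpanner {P : Finset Plane} (t : ℝ≥0∞) (G : SimpleGraph P) : Prop :=
  ∀ a b : P, graphDist G a b ≤ t * edist (a : Plane) (b : Plane)

/-- The spanning ratio of the family of all `Θ₅`-graphs (of finite point sets in general
position): the least `t` such that every graph of the family is a `t`-spanner. -/
def spanningRatio : ℝ≥0∞ :=
  sInf {t : ℝ≥0∞ | ∀ P : Finset Plane, GeneralPosition P → IsGeomSpanner t (thetaGraph P)}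

/-! ### Canonical triangles and the 31-point construction

When `b` lies in cone `i` of `a`, the canonical triangle of `(a, b)` is bounded by the cone `i` of
`a` and the line through `b` perpendicular to its bisector. -/

/-- The clockwise corner of the canonical triangle of `(a, b)`, for `b` in cone `i` of `a`. -/
def cwCorner (i : Fin 5) (a b : Plane) : Plane :=
  a + (height i a b / Real.cos (Real.pi / 5)) • cwSide i

/-- The counterclockwise corner of the canonical triangle of `(a, b)`, for `b` in cone `i`
of `a`. -/
def ccwCorner (i : Fin 5) (a b : Plane) : Plane :=
  a + (height i a b / Real.cos (Real.pi / 5)) • ccwSide i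

/-- `x` lies in the interior of the canonical triangle of `(a, b)`, for `b` in cone `i` of `a`. -/
def InTriangle (i : Fin 5) (a b x : Plane) : Prop :=
  0 < cross (cwSide i) (x - a) ∧ 0 < cross (x - a) (ccwSide i) ∧ height i a x < height i a b

/-- `x` lies in the interior of the canonical triangle of `(a, b)`, within `η` of its clockwise
corner. -/
def NearCw (η : ℝ) (a b x : Plane) : Prop :=
  ∃ i, InCone i a b ∧ InTriangle i a b x ∧ dist x (cwCorner i a b) < η

/-- `x` lies in the interior of the canonical triangle of `(a, b)`, within `η` of its
counterclockwise corner. -/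
def NearCcw (η : ℝ) (a b x : Plane) : Prop :=
  ∃ i, InCone i a b ∧ InTriangle i a b x ∧ dist x (ccwCorner i a b) < η

/-- `x` lies in the interiors of both canonical triangles of `a` and `b`. -/
def InBothTriangles (a b x : Plane) : Prop :=
  ∃ i j, InCone i a b ∧ InCone j b a ∧ InTriangle i a b x ∧ InTriangle j b a x

/-- The points `v 1, …, v 31` are placed step by step as in the lower bound construction, with
"arbitrarily close" read as "at distance less than `η`". Field `step_k` is the `k`-th step; step 1
is the choice of an arbitrary first vertex `v 1`. -/
structure Construction (η : ℝ) (v : ℕ → Plane) : Prop where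
  step_2 : InCone 0 (v 1) (v 2) ∧ dist (v 2) (cwCorner 0 (v 1) (v 2)) < η
  step_3 : NearCcw η (v 1) (v 2) (v 3) ∧ NearCcw η (v 2) (v 1) (v 4)
  step_4 : NearCw η (v 1) (v 4) (v 5) ∧ NearCcw η (v 4) (v 1) (v 6)
  step_5 : NearCw η (v 2) (v 3) (v 7) ∧ NearCcw η (v 3) (v 2) (v 8)
  step_6 : NearCw η (v 1) (v 6) (v 9) ∧ NearCcw η (v 6) (v 1) (v 10)
  step_7 : NearCcw η (v 4) (v 5) (v 11) ∧ NearCw η (v 5) (v 4) (v 12)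
  step_8 : NearCcw η (v 5) (v 6) (v 13) ∧ NearCw η (v 6) (v 5) (v 14)
  step_9 : NearCcw η (v 5) (v 14) (v 15) ∧ NearCw η (v 14) (v 5) (v 16)
  step_10 : NearCw η (v 6) (v 13) (v 17) ∧ NearCcw η (v 13) (v 6) (v 18)
  /-- `v 19` lies in both canonical triangles of `v 2` and `v 8`, close to the point where the
  clockwise side of the first meets the counterclockwise side of the second. -/
  step_11 : InBothTriangles (v 2) (v 8) (v 19) ∧
    ∃ i j, InCone i (v 2) (v 8) ∧ InCone j (v 8) (v 2) ∧
      ∃ s t : ℝ, 0 ≤ s ∧ 0 ≤ t ∧ v 2 + s • cwSide i = v 8 + t • ccwSide j ∧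
        dist (v 19) (v 2 + s • cwSide i) < η
  step_12 : NearCcw η (v 3) (v 7) (v 20) ∧ NearCw η (v 7) (v 3) (v 21)
  step_13 : NearCcw η (v 2) (v 12) (v 22)
  /-- `v 23` lies in both canonical triangles of `v 1` and `v 10`, close to the top
  (counterclockwise) boundary of cone `1` of `v 10`, and `v 1` lies in cone `1` of `v 23`, close to
  the bottom (clockwise) boundary of that cone. -/
  step_14 : InBothTriangles (v 1) (v 10) (v 23) ∧
    (∃ s : ℝ, 0 ≤ s ∧ dist (v 23) (v 10 + s • ccwSide 1) < η) ∧
    InCone 1 (v 23) (v 1) ∧ ∃ t : ℝ, 0 ≤ t ∧ dist (v 1) (v 23 + t • cwSide 1) < η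
  step_15 : NearCcw η (v 4) (v 12) (v 24) ∧ NearCw η (v 12) (v 4) (v 25)
  step_16 : NearCw η (v 13) (v 14) (v 26) ∧ NearCcw η (v 14) (v 13) (v 27)
  step_17 : NearCw η (v 9) (v 18) (v 28) ∧ NearCcw η (v 18) (v 9) (v 29)
  step_18 : NearCcw η (v 11) (v 16) (v 30) ∧ NearCw η (v 16) (v 11) (v 31)

end Theta5

end

namespace Theta5

open Filter Topology

/-! ### Golden integers and their first-order germs -/

/-! The extremal configuration is degenerate: each new point would sit exactly at a corner of a
canonical triangle, where cone membership and closeness are tied. So the points move affinely in a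
small ε > 0. Their positions at ε = 0 are the exact corners, and the first-order terms push them
into the triangles and break the ties. Measured in units of sin(2π/5) horizontally, all coordinates
lie in ℤ[φ]. Up to positive factors, so do all the linear forms that decide cone membership, height
order and general position. Their signs for small ε are lexicographic signs of pairs of golden
integers, so each condition of the construction becomes a finite exact computation (`generic_check`,
`edge_check`, `closest_check`). "Close" is continuity: a point and its corner have the same limit.

That the path 1, 23, 10, 6, 4, 2 is shortest is certified by a dual solution, a `potential` on the
vertices that changes along every edge by at most the length of the edge. Summing along any walk
bounds its length below by the difference of the potential at its ends (`le_walkLength`). On the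
path the potential is the length travelled, so the bound is attained. Elsewhere it is a constant
with enough room: any pair not adjacent on the path either satisfies the inequality strictly in the
limit, which persists for small ε, or is not an edge.

In the limit the path has length 22φ - 28 and |v₁v₂| = 2, so the ratio is 11φ - 14 = (11√5 - 17)/2.
Finitely many conditions, each valid for all small ε > 0, hold at a common ε
(`exists_construction`). Letting δ tend to 0 bounds the spanning ratio. -/

/-- The golden integer `a + b φ`. -/
structure ZPhi where
  a : ℤ
  b : ℤ

namespace ZPhi

instance : Add ZPhi := ⟨fun x y => ⟨x.a + y.a, x.b + y.b⟩⟩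
instance : Sub ZPhi := ⟨fun x y => ⟨x.a - y.a, x.b - y.b⟩⟩
instance : Mul ZPhi :=
  ⟨fun x y => ⟨x.a * y.a + x.b * y.b, x.a * y.b + x.b * y.a + x.b * y.b⟩⟩

/-- The real value of a golden integer. -/
noncomputable def val (x : ZPhi) : ℝ := x.a + x.b * Real.goldenRatio

@[simp] theorem val_mk (a b : ℤ) : val ⟨a, b⟩ = a + b * Real.goldenRatio := rfl

@[simp] theorem val_add (x y : ZPhi) : (x + y).val = x.val + y.val := by
  change val ⟨x.a + y.a, x.b + y.b⟩ = _
  simp only [val]; push_cast; ring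

@[simp] theorem val_sub (x y : ZPhi) : (x - y).val = x.val - y.val := by
  change val ⟨x.a - y.a, x.b - y.b⟩ = _
  simp only [val]; push_cast; ring

@[simp] theorem val_mul (x y : ZPhi) : (x * y).val = x.val * y.val := by
  change val ⟨x.a * y.a + x.b * y.b, x.a * y.b + x.b * y.a + x.b * y.b⟩ = _
  simp only [val]; push_cast
  linear_combination (-(x.b * y.b : ℝ)) * Real.goldenRatio_sq

/-- Decides whether a golden integer vanishes. -/
def isZero (x : ZPhi) : Bool := decide (x.a = 0) && decide (x.b = 0)

/-- Decides whether a golden integer is nonzero, by its norm. -/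
def nonzero (x : ZPhi) : Bool := !decide (x.a * x.a + x.a * x.b = x.b * x.b)

/-- Decides whether a golden integer is positive. -/
def pos (x : ZPhi) : Bool :=
  let A := 2 * x.a + x.b
  let B := x.b
  (decide (0 ≤ A) && decide (0 < B)) || (decide (0 < A) && decide (0 ≤ B)) ||
    (decide (0 < A) && decide (5 * (B * B) < A * A)) ||
    (decide (0 < B) && decide (A * A < 5 * (B * B)))

theorem val_eq_zero {x : ZPhi} (h : x.isZero = true) : x.val = 0 := by
  simp only [isZero, Bool.and_eq_true, decide_eq_true_eq] at h
  simp [val, h.1, h.2]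

/-- The norm a² + ab - b² is the product of a + bφ and its conjugate a + b - bφ, so it vanishes if
the value does. -/
theorem val_ne_zero {x : ZPhi} (h : x.nonzero = true) : x.val ≠ 0 := by
  simp only [nonzero, Bool.not_eq_true', decide_eq_false_iff_not] at h
  intro h0
  apply h
  have : ((x.a * x.a + x.a * x.b - x.b * x.b : ℤ) : ℝ) = 0 := by
    push_cast
    have e : (x.a * x.a + x.a * x.b - x.b * x.b : ℝ)
        = (x.a + x.b * Real.goldenRatio) * (x.a + x.b - x.b * Real.goldenRatio) := by
      linear_combination ((x.b * x.b : ℝ)) * Real.goldenRatio_sq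
    rw [e]
    have h0' : (x.a + x.b * Real.goldenRatio : ℝ) = 0 := h0
    rw [h0', zero_mul]
  have := Int.cast_eq_zero.1 this
  linarith

/-- Twice the value is A + B√5 with A = 2a + b and B = b. When A and B have opposite signs,
comparing A² with 5B² decides. -/
theorem val_pos {x : ZPhi} (h : x.pos = true) : 0 < x.val := by
  have e : x.val = (((2 * x.a + x.b : ℤ) : ℝ) + (x.b : ℝ) * √5) / 2 := by
    simp only [val, Real.goldenRatio]; push_cast; ring
  have s5 : (0 : ℝ) < √5 := by positivity
  have sq5 : √5 * √5 = 5 := Real.mul_self_sqrt (by norm_num)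
  rw [e]
  simp only [pos, Bool.or_eq_true, Bool.and_eq_true, decide_eq_true_eq] at h
  generalize 2 * x.a + x.b = A at h ⊢
  generalize x.b = B at h ⊢
  apply div_pos _ two_pos
  rcases h with ((⟨hA, hB⟩ | ⟨hA, hB⟩) | ⟨hA, hB⟩) | ⟨hB, hA⟩
  · have hA : (0 : ℝ) ≤ A := by exact_mod_cast hA
    have hB : (0 : ℝ) < B := by exact_mod_cast hB
    positivity
  · have hA : (0 : ℝ) < A := by exact_mod_cast hA
    have hB : (0 : ℝ) ≤ B := by exact_mod_cast hB
    positivity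
  · have hA : (0 : ℝ) < A := by exact_mod_cast hA
    have hB : (5 * (B * B) : ℝ) < A * A := by exact_mod_cast hB
    have := abs_lt_of_sq_lt_sq (a := (B : ℝ) * √5) (b := (A : ℝ))
      (by calc ((B : ℝ) * √5) ^ 2 = (B * B) * (√5 * √5) := by ring
            _ < (A : ℝ) ^ 2 := by rw [sq5]; linarith) hA.le
    linarith [(abs_lt.1 this).1]
  · have hB : (0 : ℝ) < B := by exact_mod_cast hB
    have hA : (A * A : ℝ) < 5 * (B * B) := by exact_mod_cast hA
    have := abs_lt_of_sq_lt_sq (a := (A : ℝ)) (b := (B : ℝ) * √5)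
      (by calc (A : ℝ) ^ 2 < (B * B) * 5 := by linarith
            _ = ((B : ℝ) * √5) ^ 2 := by linear_combination (-(B * B : ℝ)) * sq5) (by positivity)
    linarith [(abs_lt.1 this).1]

end ZPhi

/-- The germ `x₀ + ε x₁` of a function of a small parameter `ε > 0`. -/
structure Germ where
  x₀ : ZPhi
  x₁ : ZPhi

namespace Germ

instance : Add Germ := ⟨fun x y => ⟨x.x₀ + y.x₀, x.x₁ + y.x₁⟩⟩
instance : Sub Germ := ⟨fun x y => ⟨x.x₀ - y.x₀, x.x₁ - y.x₁⟩⟩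

/-- Multiplication of a germ by a golden integer. -/
def scale (c : ZPhi) (x : Germ) : Germ := ⟨c * x.x₀, c * x.x₁⟩

/-- The value of a germ at `ε`. -/
noncomputable def eval (x : Germ) (ε : ℝ) : ℝ := x.x₀.val + ε * x.x₁.val

@[simp] theorem eval_add (x y : Germ) (ε : ℝ) : (x + y).eval ε = x.eval ε + y.eval ε := by
  change (x.x₀ + y.x₀).val + ε * (x.x₁ + y.x₁).val = _
  simp only [eval, ZPhi.val_add]; ring

@[simp] theorem eval_sub (x y : Germ) (ε : ℝ) : (x - y).eval ε = x.eval ε - y.eval ε := by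
  change (x.x₀ - y.x₀).val + ε * (x.x₁ - y.x₁).val = _
  simp only [eval, ZPhi.val_sub]; ring

@[simp] theorem eval_scale (c : ZPhi) (x : Germ) (ε : ℝ) :
    (scale c x).eval ε = c.val * x.eval ε := by
  simp only [eval, scale, ZPhi.val_mul]; ring

theorem eval_zero (x : Germ) : x.eval 0 = x.x₀.val := by simp [eval]

@[fun_prop]
theorem continuous_eval (x : Germ) : Continuous x.eval := by
  unfold eval; fun_prop

/-- Decides whether a germ is positive. -/
def pos (x : Germ) : Bool := x.x₀.pos || (x.x₀.isZero && x.x₁.pos)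

/-- Decides whether a germ is nonzero. -/
def nonzero (x : Germ) : Bool := x.x₀.nonzero || x.x₁.nonzero

/-- A positive constant term wins by continuity; if it is zero, the linear coefficient gives the
sign. -/
theorem eventually_pos {x : Germ} (h : x.pos = true) : ∀ᶠ ε in 𝓝[>] 0, 0 < x.eval ε := by
  simp only [pos, Bool.or_eq_true, Bool.and_eq_true] at h
  rcases h with h | ⟨h0, h1⟩
  · have : 0 < x.eval 0 := by rw [eval_zero]; exact ZPhi.val_pos h
    exact (x.continuous_eval.continuousAt.eventually_const_lt this).filter_mono
      nhdsWithin_le_nhds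
  · filter_upwards [self_mem_nhdsWithin] with ε hε
    rw [eval, ZPhi.val_eq_zero h0, zero_add]
    exact mul_pos hε (ZPhi.val_pos h1)

theorem eventually_ne_zero {x : Germ} (h : x.nonzero = true) :
    ∀ᶠ ε in 𝓝[>] 0, x.eval ε ≠ 0 := by
  by_cases h0 : x.x₀.val = 0
  · simp only [nonzero, Bool.or_eq_true] at h
    have h1 : x.x₁.val ≠ 0 := by
      rcases h with h | h
      · exact absurd h0 (ZPhi.val_ne_zero h)
      · exact ZPhi.val_ne_zero h
    filter_upwards [self_mem_nhdsWithin] with ε hε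
    rw [eval, h0, zero_add]
    exact mul_ne_zero (ne_of_gt hε) h1
  · have : x.eval 0 ≠ 0 := by rwa [eval_zero]
    exact (x.continuous_eval.continuousAt.eventually_ne this).filter_mono nhdsWithin_le_nhds

end Germ

/-! ### Moving points -/

/-- A point moving with `ε`, with coordinates `(sin (2π/5) X, Y)`. -/
structure GermPoint where
  X : Germ
  Y : Germ

namespace GermPoint

instance : Sub GermPoint := ⟨fun p q => ⟨p.X - q.X, p.Y - q.Y⟩⟩

@[simp] theorem sub_X (p q : GermPoint) : (p - q).X = p.X - q.X := rfl
@[simp] theorem sub_Y (p q : GermPoint) : (p - q).Y = p.Y - q.Y := rfl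

/-- The position of a moving point at `ε`. -/
noncomputable def eval (p : GermPoint) (ε : ℝ) : Plane :=
  !₂[Real.sin (2 * Real.pi / 5) * p.X.eval ε, p.Y.eval ε]

@[simp] theorem eval_zero (p : GermPoint) (ε : ℝ) :
    p.eval ε 0 = Real.sin (2 * Real.pi / 5) * p.X.eval ε := rfl

@[simp] theorem eval_one (p : GermPoint) (ε : ℝ) : p.eval ε 1 = p.Y.eval ε := rfl

@[fun_prop]
theorem continuous (p : GermPoint) : Continuous p.eval := by
  unfold eval
  apply (PiLp.continuous_toLp 2 _).comp
  apply continuous_pi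
  intro i
  fin_cases i
  · exact continuous_const.mul p.X.continuous_eval
  · exact p.Y.continuous_eval

end GermPoint

/-! ### The directions of the cone boundaries -/

/-- The first coordinate of `cwSide i` in units of `sin (2π/5)`. -/
def dirX (i : Fin 5) : ZPhi :=
  match i with
  | 0 => ⟨-1, 1⟩
  | 1 => ⟨1, 0⟩
  | 2 => ⟨0, 0⟩
  | 3 => ⟨-1, 0⟩
  | 4 => ⟨1, -1⟩

/-- Twice the second coordinate of `cwSide i`. -/
def dirY (i : Fin 5) : ZPhi :=
  match i with
  | 0 => ⟨0, 1⟩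
  | 1 => ⟨1, -1⟩
  | 2 => ⟨-2, 0⟩
  | 3 => ⟨1, -1⟩
  | 4 => ⟨0, 1⟩

theorem cos_pi_div_five_eq : Real.cos (Real.pi / 5) = Real.goldenRatio / 2 := by
  rw [Real.cos_pi_div_five, Real.goldenRatio]; ring

theorem cos_two_pi_div_five_eq :
    Real.cos (2 * Real.pi / 5) = (Real.goldenRatio - 1) / 2 := by
  rw [show 2 * Real.pi / 5 = 2 * (Real.pi / 5) by ring, Real.cos_two_mul, cos_pi_div_five_eq]
  linear_combination (1 / 2) * Real.goldenRatio_sq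

/-- The sine is not in ℚ(√5), but its square is. With first coordinates in units of the sine, inner
products are therefore golden and determinants are golden up to one common positive factor. -/
theorem sin_sq_two_pi_div_five :
    Real.sin (2 * Real.pi / 5) ^ 2 = (2 + Real.goldenRatio) / 4 := by
  rw [Real.sin_sq, cos_two_pi_div_five_eq]
  linear_combination (-1 / 4) * Real.goldenRatio_sq

theorem sin_two_pi_div_five_pos : 0 < Real.sin (2 * Real.pi / 5) :=
  Real.sin_pos_of_pos_of_lt_pi (by positivity) (by linarith [Real.pi_pos])

theorem sin_pi_div_five_eq :
    Real.sin (Real.pi / 5) = Real.sin (2 * Real.pi / 5) * (Real.goldenRatio - 1) := by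
  rw [show 2 * Real.pi / 5 = 2 * (Real.pi / 5) by ring, Real.sin_two_mul, cos_pi_div_five_eq]
  linear_combination (- Real.sin (Real.pi / 5)) * Real.goldenRatio_sq

theorem cwSide_eq (i : Fin 5) :
    cwSide i = !₂[Real.sin (2 * Real.pi / 5) * (dirX i).val, (dirY i).val / 2] := by
  -- Angles are now measured clockwise from the vertical, which turns (cos, sin) into (sin, cos).
  have key : cwSide i = !₂[Real.sin (Real.pi / 5 + (i : ℕ) * (2 * Real.pi / 5)),
      Real.cos (Real.pi / 5 + (i : ℕ) * (2 * Real.pi / 5))] := by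
    rw [cwSide, unitVec, bisectorAngle,
      show Real.pi / 2 - (i : ℕ) * (2 * Real.pi / 5) - Real.pi / 5
        = Real.pi / 2 - (Real.pi / 5 + (i : ℕ) * (2 * Real.pi / 5)) by ring,
      Real.cos_pi_div_two_sub, Real.sin_pi_div_two_sub]
  rw [key]
  fin_cases i
  · simp only [dirX, dirY]
    rw [show Real.pi / 5 + (((⟨0, by norm_num⟩ : Fin 5) : ℕ) : ℝ) * (2 * Real.pi / 5)
      = Real.pi / 5 by push_cast; ring, sin_pi_div_five_eq, cos_pi_div_five_eq]
    simp; left; ring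
  · simp only [dirX, dirY]
    rw [show Real.pi / 5 + (((⟨1, by norm_num⟩ : Fin 5) : ℕ) : ℝ) * (2 * Real.pi / 5)
      = Real.pi - 2 * Real.pi / 5 by push_cast; ring, Real.sin_pi_sub, Real.cos_pi_sub,
      cos_two_pi_div_five_eq]
    simp; ring
  · simp only [dirX, dirY]
    rw [show Real.pi / 5 + (((⟨2, by norm_num⟩ : Fin 5) : ℕ) : ℝ) * (2 * Real.pi / 5)
      = Real.pi by push_cast; ring]
    simp
  · simp only [dirX, dirY]
    rw [show Real.pi / 5 + (((⟨3, by norm_num⟩ : Fin 5) : ℕ) : ℝ) * (2 * Real.pi / 5)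
      = 2 * Real.pi / 5 + Real.pi by push_cast; ring, Real.sin_add_pi, Real.cos_add_pi,
      cos_two_pi_div_five_eq]
    simp; ring
  · simp only [dirX, dirY]
    rw [show Real.pi / 5 + (((⟨4, by norm_num⟩ : Fin 5) : ℕ) : ℝ) * (2 * Real.pi / 5)
      = 2 * Real.pi - Real.pi / 5 by push_cast; ring, Real.sin_two_pi_sub,
      Real.cos_two_pi_sub, sin_pi_div_five_eq, cos_pi_div_five_eq]
    simp; ring

theorem unitVec_add_two_pi (x : ℝ) : unitVec (x + 2 * Real.pi) = unitVec x := by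
  simp [unitVec]

theorem unitVec_add_pi (x : ℝ) : unitVec (x + Real.pi) = -unitVec x := by
  ext i; fin_cases i <;> simp [unitVec]

/-- Cones are numbered clockwise, so the counterclockwise neighbour of cone i is i - 1, which is i +
4 modulo 5. -/
theorem ccwSide_eq (i : Fin 5) : ccwSide i = cwSide (i + 4) := by
  have h : ∀ x y : ℝ, x = y ∨ x = y + 2 * Real.pi ∨ y = x + 2 * Real.pi →
      unitVec x = unitVec y := by
    rintro x y (h | h | h)
    · rw [h]
    · rw [h, unitVec_add_two_pi]
    · rw [h, unitVec_add_two_pi]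
  apply h
  fin_cases i <;> norm_num [bisectorAngle, Fin.val_add]
  · right; left; ring
  all_goals left; ring

/-- Five is odd, so opposite each bisector runs a cone boundary. Heights thus reduce to inner
products with `cwSide`. -/
theorem bisector_eq (i : Fin 5) : bisector i = -cwSide (i + 2) := by
  have h : ∀ x y : ℝ, x = y + Real.pi ∨ x + Real.pi = y → unitVec x = -unitVec y := by
    rintro x y (h | h)
    · rw [h, unitVec_add_pi]
    · rw [← h, unitVec_add_pi, neg_neg]
  apply h
  fin_cases i <;> norm_num [bisectorAngle, Fin.val_add]
  all_goals first | (left; ring1) | (right; ring1)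

/-! ### The linear forms that decide membership in cones and triangles -/

/-- `2 / sin (2π/5)` times the determinant of `cwSide i` and `p`. -/
def crossForm (i : Fin 5) (p : GermPoint) : Germ :=
  (p.Y.scale (dirX i) + p.Y.scale (dirX i)) - p.X.scale (dirY i)

/-- Four times the inner product of `cwSide i` and `p`. -/
def innerForm (i : Fin 5) (p : GermPoint) : Germ :=
  (p.X.scale (dirX i)).scale ⟨2, 1⟩ + (p.Y.scale (dirY i) + p.Y.scale (dirY i))

theorem cross_cwSide (i : Fin 5) (p q : GermPoint) (ε : ℝ) :
    cross (cwSide i) (q.eval ε - p.eval ε) =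
      Real.sin (2 * Real.pi / 5) / 2 * (crossForm i (q - p)).eval ε := by
  simp [cross, cwSide_eq, crossForm]; ring

theorem cross_ccwSide (i : Fin 5) (p q : GermPoint) (ε : ℝ) :
    cross (q.eval ε - p.eval ε) (ccwSide i) =
      Real.sin (2 * Real.pi / 5) / 2 * (crossForm (i + 4) (p - q)).eval ε := by
  simp [cross, ccwSide_eq, cwSide_eq, crossForm]; ring

theorem inner_cwSide (i : Fin 5) (p q : GermPoint) (ε : ℝ) :
    inner ℝ (cwSide i) (q.eval ε - p.eval ε) = 1 / 4 * (innerForm i (q - p)).eval ε := by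
  simp [cwSide_eq, innerForm, PiLp.inner_apply, Fin.sum_univ_two]
  linear_combination ((q.X.eval ε - p.X.eval ε) * (dirX i).val) * sin_sq_two_pi_div_five

theorem height_eq (i : Fin 5) (p q : GermPoint) (ε : ℝ) :
    height i (p.eval ε) (q.eval ε) = 1 / 4 * (innerForm (i + 2) (p - q)).eval ε := by
  rw [height, bisector_eq, ← inner_cwSide, inner_neg_left, ← inner_neg_right, neg_sub]

/-- Decides whether `q` lies in the interior of cone `i` of `p`. -/
def inCone (i : Fin 5) (p q : GermPoint) : Bool :=
  (crossForm i (q - p)).pos && (crossForm (i + 4) (p - q)).pos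

/-- Decides whether `q` lies outside the closed cone `i` of `p`. -/
def notInCone (i : Fin 5) (p q : GermPoint) : Bool :=
  (crossForm i (p - q)).pos || (crossForm (i + 4) (q - p)).pos

/-- Decides whether `p` is lower than `q` in the direction of the bisector of cone `i`. -/
def lower (i : Fin 5) (p q : GermPoint) : Bool := (innerForm (i + 2) (p - q)).pos

theorem crossForm_swap (i : Fin 5) (p q : GermPoint) (ε : ℝ) :
    (crossForm i (p - q)).eval ε = -(crossForm i (q - p)).eval ε := by
  simp [crossForm]; ring

theorem innerForm_sub (i : Fin 5) (a p q : GermPoint) (ε : ℝ) :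
    (innerForm i (p - q)).eval ε
      = (innerForm i (a - q)).eval ε - (innerForm i (a - p)).eval ε := by
  simp [innerForm]; ring

theorem eventually_cross {i : Fin 5} {p q : GermPoint}
    (h : (crossForm i (q - p)).pos = true) :
    ∀ᶠ ε in 𝓝[>] 0, 0 < cross (cwSide i) (q.eval ε - p.eval ε) := by
  filter_upwards [Germ.eventually_pos h] with ε hε
  rw [cross_cwSide]
  have := sin_two_pi_div_five_pos
  positivity

theorem eventually_cross' {i : Fin 5} {p q : GermPoint}
    (h : (crossForm (i + 4) (p - q)).pos = true) :
    ∀ᶠ ε in 𝓝[>] 0, 0 < cross (q.eval ε - p.eval ε) (ccwSide i) := by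
  filter_upwards [Germ.eventually_pos h] with ε hε
  rw [cross_ccwSide]
  have := sin_two_pi_div_five_pos
  positivity

theorem eventually_inCone {i : Fin 5} {p q : GermPoint} (h : inCone i p q = true) :
    ∀ᶠ ε in 𝓝[>] 0, InCone i (p.eval ε) (q.eval ε) := by
  simp only [inCone, Bool.and_eq_true] at h
  filter_upwards [eventually_cross h.1, eventually_cross' h.2] with ε h1 h2
  exact ⟨h1.le, h2⟩

theorem eventually_not_inCone {i : Fin 5} {p q : GermPoint} (h : notInCone i p q = true) :
    ∀ᶠ ε in 𝓝[>] 0, ¬ InCone i (p.eval ε) (q.eval ε) := by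
  simp only [notInCone, Bool.or_eq_true] at h
  have hs := sin_two_pi_div_five_pos
  rcases h with h | h
  · filter_upwards [Germ.eventually_pos h] with ε hε hc
    have := hc.1
    rw [cross_cwSide, ← neg_neg ((crossForm i (q - p)).eval ε), ← crossForm_swap] at this
    nlinarith
  · filter_upwards [Germ.eventually_pos h] with ε hε hc
    have := hc.2
    rw [cross_ccwSide, crossForm_swap] at this
    nlinarith

/-- The difference of two heights does not depend on the apex, so one test serves all `a`. -/
theorem eventually_lower {i : Fin 5} {p q : GermPoint} (h : lower i p q = true) :
    ∀ᶠ ε in 𝓝[>] 0, ∀ a : GermPoint,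
      height i (a.eval ε) (p.eval ε) < height i (a.eval ε) (q.eval ε) := by
  filter_upwards [Germ.eventually_pos h] with ε hε a
  rw [innerForm_sub _ a] at hε
  rw [height_eq, height_eq]
  linarith

/-- Decides whether `x` lies in the interior of the canonical triangle of `(a, b)`. -/
def inTriangle (i : Fin 5) (a b x : GermPoint) : Bool := inCone i a x && lower i x b

theorem eventually_inTriangle {i : Fin 5} {a b x : GermPoint} (h : inTriangle i a b x = true) :
    ∀ᶠ ε in 𝓝[>] 0, InTriangle i (a.eval ε) (b.eval ε) (x.eval ε) := by
  simp only [inTriangle, inCone, Bool.and_eq_true] at h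
  filter_upwards [eventually_cross h.1.1, eventually_cross' h.1.2, eventually_lower h.2]
    with ε h1 h2 h3
  exact ⟨h1, h2, h3 a⟩

/-- Decides whether two points do not lie on a line parallel or perpendicular to a cone
boundary. -/
def generic (p q : GermPoint) : Bool :=
  (List.finRange 5).all fun i =>
    (crossForm i (q - p)).nonzero && (innerForm i (q - p)).nonzero

theorem eventually_generic {p q : GermPoint} (h : generic p q = true) :
    ∀ᶠ ε in 𝓝[>] 0, ∀ i : Fin 5, cross (cwSide i) (q.eval ε - p.eval ε) ≠ 0 ∧
      inner ℝ (cwSide i) (q.eval ε - p.eval ε) ≠ 0 := by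
  rw [eventually_all]
  intro i
  simp only [generic, List.all_eq_true, List.mem_finRange, Bool.and_eq_true, true_imp_iff] at h
  filter_upwards [Germ.eventually_ne_zero (h i).1, Germ.eventually_ne_zero (h i).2] with ε h1 h2
  rw [cross_cwSide, inner_cwSide]
  have := sin_two_pi_div_five_pos
  exact ⟨by positivity, by positivity⟩

/-! ### Limits of the moving points -/

/-- Decides whether the limit of `x` is the limit of `a` moved by `(l / 4) cwSide i`. -/
def limitIsShift (i : Fin 5) (l : ZPhi) (a x : GermPoint) : Bool :=
  ((x - a).X.x₀ * ⟨4, 0⟩ - l * dirX i).isZero &&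
    ((x - a).Y.x₀ * ⟨8, 0⟩ - l * dirY i).isZero

theorem limit_eq_shift {i : Fin 5} {l : ZPhi} {a x : GermPoint}
    (h : limitIsShift i l a x = true) : x.eval 0 = a.eval 0 + (l.val / 4) • cwSide i := by
  simp only [limitIsShift, Bool.and_eq_true, GermPoint.sub_X, GermPoint.sub_Y] at h
  have h1 := ZPhi.val_eq_zero h.1
  have h2 := ZPhi.val_eq_zero h.2
  change ((x.X.x₀ - a.X.x₀) * _ - _ : ZPhi).val = 0 at h1
  change ((x.Y.x₀ - a.Y.x₀) * _ - _ : ZPhi).val = 0 at h2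
  simp at h1 h2
  ext j
  rw [cwSide_eq]
  fin_cases j
  · simp [Germ.eval_zero]
    linear_combination (Real.sin (2 * Real.pi / 5) / 4) * h1
  · simp [Germ.eval_zero]
    linear_combination (1 / 8) * h2

/-- Four times the side length of the limit of the canonical triangle of `(a, b)`. -/
def sideLimit (i : Fin 5) (a b : GermPoint) : ZPhi :=
  ⟨-2, 2⟩ * (innerForm (i + 2) (a - b)).x₀

/-- Since 1 / cos(π/5) = 2/φ = 2φ - 2, the side length stays in ℤ[φ] after scaling by 4; this is the
factor ⟨-2, 2⟩. -/
theorem sideLimit_eq (i : Fin 5) (a b : GermPoint) :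
    (sideLimit i a b).val / 4 =
      height i (a.eval 0) (b.eval 0) / Real.cos (Real.pi / 5) := by
  rw [height_eq, cos_pi_div_five_eq, sideLimit, Germ.eval_zero]
  have := Real.goldenRatio_pos
  field_simp
  simp
  linear_combination (4 * (innerForm (i + 2) (a - b)).x₀.val) * Real.goldenRatio_sq

theorem continuous_height (i : Fin 5) (a b : GermPoint) :
    Continuous fun ε => height i (a.eval ε) (b.eval ε) := by
  simp only [height_eq]; fun_prop

theorem continuous_cwCorner (i : Fin 5) (a b : GermPoint) :
    Continuous fun ε => cwCorner i (a.eval ε) (b.eval ε) := by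
  have := continuous_height i a b
  unfold cwCorner; fun_prop

theorem continuous_ccwCorner (i : Fin 5) (a b : GermPoint) :
    Continuous fun ε => ccwCorner i (a.eval ε) (b.eval ε) := by
  have := continuous_height i a b
  unfold ccwCorner; fun_prop

theorem cwCorner_limit {i : Fin 5} {a b x : GermPoint}
    (h : limitIsShift i (sideLimit i a b) a x = true) :
    x.eval 0 = cwCorner i (a.eval 0) (b.eval 0) := by
  rw [limit_eq_shift h, cwCorner, sideLimit_eq]

theorem ccwCorner_limit {i : Fin 5} {a b x : GermPoint}
    (h : limitIsShift (i + 4) (sideLimit i a b) a x = true) :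
    x.eval 0 = ccwCorner i (a.eval 0) (b.eval 0) := by
  rw [limit_eq_shift h, ccwCorner, sideLimit_eq, ccwSide_eq]

/-- The left distance tends to 0 while the right side keeps a positive limit. This provides every
tolerance δ|v₁v₂|. -/
theorem eventually_dist_lt {f g h : ℝ → Plane} (hf : Continuous f) (hg : Continuous g)
    (hh : Continuous h) {k : ℝ → Plane} (hk : Continuous k)
    (h0 : f 0 = g 0) (h1 : h 0 ≠ k 0) {δ : ℝ} (hδ : 0 < δ) :
    ∀ᶠ ε in 𝓝[>] 0, dist (f ε) (g ε) < δ * dist (h ε) (k ε) := by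
  have c1 : Continuous fun ε => dist (f ε) (g ε) := by fun_prop
  have c2 : Continuous fun ε => δ * dist (h ε) (k ε) := by fun_prop
  refine (c1.continuousAt.eventually_lt c2.continuousAt ?_).filter_mono nhdsWithin_le_nhds
  rw [h0, dist_self]
  exact mul_pos hδ (dist_pos.2 h1)

/-- Decides `NearCw` for small `ε`. -/
def nearCw (i : Fin 5) (a b x : GermPoint) : Bool :=
  inCone i a b && inTriangle i a b x && limitIsShift i (sideLimit i a b) a x

/-- Decides `NearCcw` for small `ε`. -/
def nearCcw (i : Fin 5) (a b x : GermPoint) : Bool :=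
  inCone i a b && inTriangle i a b x && limitIsShift (i + 4) (sideLimit i a b) a x

theorem eventually_nearCw (i : Fin 5) {a b x : GermPoint} (h : nearCw i a b x = true)
    {p q : GermPoint} (hpq : p.eval 0 ≠ q.eval 0) {δ : ℝ} (hδ : 0 < δ) :
    ∀ᶠ ε in 𝓝[>] 0, NearCw (δ * dist (p.eval ε) (q.eval ε)) (a.eval ε) (b.eval ε) (x.eval ε) := by
  simp only [nearCw, Bool.and_eq_true] at h
  filter_upwards [eventually_inCone h.1.1, eventually_inTriangle h.1.2,
    eventually_dist_lt x.continuous (continuous_cwCorner i a b) p.continuous q.continuous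
      (cwCorner_limit h.2) hpq hδ] with ε h1 h2 h3
  exact ⟨i, h1, h2, h3⟩

theorem eventually_nearCcw (i : Fin 5) {a b x : GermPoint} (h : nearCcw i a b x = true)
    {p q : GermPoint} (hpq : p.eval 0 ≠ q.eval 0) {δ : ℝ} (hδ : 0 < δ) :
    ∀ᶠ ε in 𝓝[>] 0,
      NearCcw (δ * dist (p.eval ε) (q.eval ε)) (a.eval ε) (b.eval ε) (x.eval ε) := by
  simp only [nearCcw, Bool.and_eq_true] at h
  filter_upwards [eventually_inCone h.1.1, eventually_inTriangle h.1.2,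
    eventually_dist_lt x.continuous (continuous_ccwCorner i a b) p.continuous q.continuous
      (ccwCorner_limit h.2) hpq hδ] with ε h1 h2 h3
  exact ⟨i, h1, h2, h3⟩

/-! ### Exact distances in the limit configuration -/

theorem dist_limit_sq (p q : GermPoint) :
    4 * dist (p.eval 0) (q.eval 0) ^ 2 = ((p - q).X.x₀ * (p - q).X.x₀ * ⟨2, 1⟩
      + (p - q).Y.x₀ * (p - q).Y.x₀ * ⟨4, 0⟩).val := by
  change _ = ((p.X.x₀ - q.X.x₀) * (p.X.x₀ - q.X.x₀) * ⟨2, 1⟩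
      + (p.Y.x₀ - q.Y.x₀) * (p.Y.x₀ - q.Y.x₀) * ⟨4, 0⟩ : ZPhi).val
  rw [EuclideanSpace.dist_eq, Real.sq_sqrt (by positivity)]
  simp [Fin.sum_univ_two, Real.dist_eq, sq_abs, Germ.eval_zero]
  linear_combination (4 * (p.X.x₀.val - q.X.x₀.val) ^ 2) * sin_sq_two_pi_div_five

/-- Decides whether the limits of `p` and `q` have distance `l`, for `l` positive. -/
def distIs (p q : GermPoint) (l : ZPhi) : Bool :=
  l.pos && ((p - q).X.x₀ * (p - q).X.x₀ * ⟨2, 1⟩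
    + (p - q).Y.x₀ * (p - q).Y.x₀ * ⟨4, 0⟩ - l * l * ⟨4, 0⟩).isZero

theorem dist_limit_eq {p q : GermPoint} {l : ZPhi} (h : distIs p q l = true) :
    dist (p.eval 0) (q.eval 0) = l.val := by
  simp only [distIs, Bool.and_eq_true] at h
  have h1 := ZPhi.val_pos h.1
  have h2 := ZPhi.val_eq_zero h.2
  rw [ZPhi.val_sub, ← dist_limit_sq] at h2
  simp at h2
  rw [← sq_eq_sq₀ dist_nonneg h1.le]
  linarith

/-- Decides whether the limits of `p` and `q` have distance more than `|x - y| / 50`. -/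
def slack (p q : GermPoint) (x y : ZPhi) : Bool :=
  ((⟨2500, 0⟩ : ZPhi) * ((p - q).X.x₀ * (p - q).X.x₀ * ⟨2, 1⟩
    + (p - q).Y.x₀ * (p - q).Y.x₀ * ⟨4, 0⟩) - (x - y) * (x - y) * ⟨4, 0⟩).pos

theorem abs_sub_lt_dist_limit {p q : GermPoint} {x y : ZPhi} (h : slack p q x y = true) :
    |x.val / 50 - y.val / 50| < dist (p.eval 0) (q.eval 0) := by
  have h1 := ZPhi.val_pos h
  rw [ZPhi.val_sub, ZPhi.val_mul, ← dist_limit_sq] at h1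
  simp at h1
  apply abs_lt_of_sq_lt_sq _ dist_nonneg
  nlinarith

/-! ### The 31 points -/

/-- The points `v₁, …, v₃₁`, preceded by a second copy of `v₁` with index `0`. -/
def pointList : List GermPoint := [
  ⟨⟨⟨0, 0⟩, ⟨0, 0⟩⟩, ⟨⟨0, 0⟩, ⟨0, 0⟩⟩⟩,
  ⟨⟨⟨0, 0⟩, ⟨0, 0⟩⟩, ⟨⟨0, 0⟩, ⟨0, 0⟩⟩⟩,
  ⟨⟨⟨-2, 2⟩, ⟨0, 0⟩⟩, ⟨⟨0, 1⟩, ⟨4, 0⟩⟩⟩,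
  ⟨⟨⟨2, -2⟩, ⟨-1, 0⟩⟩, ⟨⟨0, 1⟩, ⟨3, 0⟩⟩⟩,
  ⟨⟨⟨-2, 2⟩, ⟨-1, 0⟩⟩, ⟨⟨4, -3⟩, ⟨1, 0⟩⟩⟩,
  ⟨⟨⟨0, 0⟩, ⟨1, 0⟩⟩, ⟨⟨8, -6⟩, ⟨3, 0⟩⟩⟩,
  ⟨⟨⟨6, -4⟩, ⟨2, 0⟩⟩, ⟨⟨-3, 1⟩, ⟨2, 0⟩⟩⟩,
  ⟨⟨⟨6, -4⟩, ⟨0, 0⟩⟩, ⟨⟨-1, 3⟩, ⟨3, 0⟩⟩⟩,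
  ⟨⟨⟨-6, 4⟩, ⟨-1, 0⟩⟩, ⟨⟨-1, 3⟩, ⟨2, 0⟩⟩⟩,
  ⟨⟨⟨8, -6⟩, ⟨6, 0⟩⟩, ⟨⟨-7, 4⟩, ⟨1, 0⟩⟩⟩,
  ⟨⟨⟨-8, 4⟩, ⟨5, 0⟩⟩, ⟨⟨0, 0⟩, ⟨-1, 0⟩⟩⟩,
  ⟨⟨⟨-2, 2⟩, ⟨-3, 0⟩⟩, ⟨⟨12, -9⟩, ⟨6, 0⟩⟩⟩,
  ⟨⟨⟨-8, 6⟩, ⟨-3, 0⟩⟩, ⟨⟨1, -2⟩, ⟨5, 0⟩⟩⟩,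
  ⟨⟨⟨22, -14⟩, ⟨4, 0⟩⟩, ⟨⟨-10, 5⟩, ⟨5, 0⟩⟩⟩,
  ⟨⟨⟨6, -4⟩, ⟨3, 0⟩⟩, ⟨⟨19, -13⟩, ⟨5, 0⟩⟩⟩,
  ⟨⟨⟨0, 0⟩, ⟨-1, 0⟩⟩, ⟨⟨30, -20⟩, ⟨8, 0⟩⟩⟩,
  ⟨⟨⟨-16, 10⟩, ⟨-2, 0⟩⟩, ⟨⟨1, -2⟩, ⟨8, 0⟩⟩⟩,
  ⟨⟨⟨28, -18⟩, ⟨9, 0⟩⟩, ⟨⟨-21, 12⟩, ⟨4, 0⟩⟩⟩,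
  ⟨⟨⟨-14, 8⟩, ⟨9, 0⟩⟩, ⟨⟨-3, 1⟩, ⟨1, 0⟩⟩⟩,
  ⟨⟨⟨-4, 4⟩, ⟨-3, 0⟩⟩, ⟨⟨0, 2⟩, ⟨1, 0⟩⟩⟩,
  ⟨⟨⟨10, -8⟩, ⟨1, 0⟩⟩, ⟨⟨-1, 3⟩, ⟨1, 0⟩⟩⟩,
  ⟨⟨⟨0, -2⟩, ⟨1, 0⟩⟩, ⟨⟨3, 0⟩, ⟨2, 0⟩⟩⟩,
  ⟨⟨⟨-14, 12⟩, ⟨-5, 0⟩⟩, ⟨⟨-11, 7⟩, ⟨5, 0⟩⟩⟩,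
  ⟨⟨⟨2, -2⟩, ⟨5, 0⟩⟩, ⟨⟨2, -1⟩, ⟨-4, 0⟩⟩⟩,
  ⟨⟨⟨-10, 8⟩, ⟨-8, 0⟩⟩, ⟨⟨-3, 1⟩, ⟨3, 0⟩⟩⟩,
  ⟨⟨⟨6, -2⟩, ⟨-8, 0⟩⟩, ⟨⟨4, -3⟩, ⟨-1, 0⟩⟩⟩,
  ⟨⟨⟨22, -14⟩, ⟨5, 0⟩⟩, ⟨⟨48, -31⟩, ⟨7, 0⟩⟩⟩,
  ⟨⟨⟨64, -40⟩, ⟨5, 0⟩⟩, ⟨⟨-28, 16⟩, ⟨6, 0⟩⟩⟩,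
  ⟨⟨⟨8, -6⟩, ⟨7, 0⟩⟩, ⟨⟨37, -24⟩, ⟨1, 0⟩⟩⟩,
  ⟨⟨⟨-28, 16⟩, ⟨8, 0⟩⟩, ⟨⟨8, -6⟩, ⟨1, 0⟩⟩⟩,
  ⟨⟨⟨42, -26⟩, ⟨-1, 0⟩⟩, ⟨⟨-24, 13⟩, ⟨8, 0⟩⟩⟩,
  ⟨⟨⟨-16, 10⟩, ⟨-1, 0⟩⟩, ⟨⟨-13, 6⟩, ⟨9, 0⟩⟩⟩]

/-- The `k`-th point of the construction. -/
def pt (k : ℕ) : GermPoint := pointList.getD k ⟨⟨⟨0, 0⟩, ⟨0, 0⟩⟩, ⟨⟨0, 0⟩, ⟨0, 0⟩⟩⟩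

/-- The indices of the points. -/
def indices : List ℕ := List.range' 1 31

/-- Fifty times the limits of the values of the potential at the points. -/
def potentialList : List ZPhi := [
  ⟨0, 0⟩, ⟨0, 0⟩, ⟨-1400, 1100⟩, ⟨99, 0⟩, ⟨-1200, 900⟩, ⟨85, 0⟩, ⟨-800, 600⟩, ⟨281, 0⟩,
  ⟨237, 0⟩, ⟨85, 0⟩, ⟨-400, 300⟩, ⟨197, 0⟩, ⟨170, 0⟩, ⟨117, 0⟩, ⟨139, 0⟩, ⟨117, 0⟩, ⟨112,
  0⟩, ⟨144, 0⟩, ⟨149, 0⟩, ⟨336, 0⟩, ⟨237, 0⟩, ⟨216, 0⟩, ⟨258, 0⟩, ⟨-100, 100⟩, ⟨242, 0⟩,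
  ⟨254, 0⟩, ⟨129, 0⟩, ⟨127, 0⟩, ⟨149, 0⟩, ⟨146, 0⟩, ⟨147, 0⟩, ⟨164, 0⟩]

/-- Fifty times the limit of the potential at the `k`-th point. -/
def potentialLimit (k : ℕ) : ZPhi := potentialList.getD k ⟨0, 0⟩

/-- Decides whether `a`, `b` are consecutive on the path `1, 23, 10, 6, 4, 2`. -/
def onPath (a b : ℕ) : Bool :=
  [(1, 23), (23, 10), (10, 6), (6, 4), (4, 2)].any fun e => a == e.1 && b == e.2

/-- Decides whether `b` is not a closest point of `a` in any cone. -/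
def blocked (a b : ℕ) : Bool :=
  (List.finRange 5).all fun i => notInCone i (pt a) (pt b) ||
    indices.any fun c => inCone i (pt a) (pt c) && lower i (pt c) (pt b)

/-- Decides whether `b` is the closest point of `a` in cone `i`. -/
def closest (i : Fin 5) (a b : ℕ) : Bool :=
  inCone i (pt a) (pt b) && indices.all fun c =>
    c == a || c == b || notInCone i (pt a) (pt c) || lower i (pt b) (pt c)

/-! ### Finite checks on the 31 points -/

theorem generic_check : (indices.all fun a => indices.all fun b =>
    decide (b ≤ a) || generic (pt a) (pt b)) = true := by decide +kernel

/-- This is the optimality certificate: a pair can be tight only if it is a path edge, and any other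
pair without slack is shown not to be an edge arising from `a`. -/
theorem edge_check : (indices.all fun a => indices.all fun b =>
    a == b || onPath a b || onPath b a ||
      slack (pt a) (pt b) (potentialLimit a) (potentialLimit b) || blocked a b) = true := by
  decide +kernel

theorem closest_check : (closest 4 1 23 && closest 1 10 23 && closest 0 6 10 && closest 1 6 4 &&
    closest 0 4 2) = true := by decide +kernel

/-! ### Path lengths and potentials -/

/-- Weak duality: the increments of `f` telescope along the walk. -/
theorem le_walkLength {P : Finset Plane} {G : SimpleGraph P} (f : P → ℝ)
    (hf : ∀ a b, G.Adj a b → f b - f a ≤ dist (a : Plane) (b : Plane)) {a b : P}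
    (w : G.Walk a b) : ENNReal.ofReal (f b - f a) ≤ walkLength w := by
  induction w with
  | nil => simp
  | @cons a c b h w ih =>
    have hw : walkLength (SimpleGraph.Walk.cons h w)
        = edist (a : Plane) (c : Plane) + walkLength w := by
      simp [walkLength]
    rw [hw, edist_dist]
    calc ENNReal.ofReal (f b - f a) = ENNReal.ofReal ((f c - f a) + (f b - f c)) := by ring_nf
      _ ≤ ENNReal.ofReal (f c - f a) + ENNReal.ofReal (f b - f c) := ENNReal.ofReal_add_le
      _ ≤ _ := add_le_add (ENNReal.ofReal_le_ofReal (hf _ _ h)) ih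

/-- The distance of two points of the construction at `ε`. -/
noncomputable def len (a b : ℕ) (ε : ℝ) : ℝ := dist ((pt a).eval ε) ((pt b).eval ε)

@[fun_prop]
theorem continuous_len (a b : ℕ) : Continuous (len a b) := by
  have := (pt a).continuous
  have := (pt b).continuous
  unfold len; fun_prop

theorem len_nonneg (a b : ℕ) (ε : ℝ) : 0 ≤ len a b ε := dist_nonneg

theorem len_comm (a b : ℕ) (ε : ℝ) : len a b ε = len b a ε := dist_comm _ _

/-- A potential on the points of the construction that bounds path lengths from below: the length
of the path on its vertices, and constant elsewhere. -/
noncomputable def potential (k : ℕ) (ε : ℝ) : ℝ :=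
  match k with
  | 1 => 0
  | 23 => len 1 23 ε
  | 10 => len 1 23 ε + len 23 10 ε
  | 6 => len 1 23 ε + len 23 10 ε + len 10 6 ε
  | 4 => len 1 23 ε + len 23 10 ε + len 10 6 ε + len 6 4 ε
  | 2 => len 1 23 ε + len 23 10 ε + len 10 6 ε + len 6 4 ε + len 4 2 ε
  | k => (potentialLimit k).val / 50

theorem continuous_potential (k : ℕ) : Continuous (potential k) := by
  unfold potential
  split <;> fun_prop

theorem path_len_zero : len 1 23 0 = ZPhi.val ⟨-2, 2⟩ ∧ len 23 10 0 = ZPhi.val ⟨-6, 4⟩ ∧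
    len 10 6 0 = ZPhi.val ⟨-8, 6⟩ ∧ len 6 4 0 = ZPhi.val ⟨-8, 6⟩ ∧
    len 4 2 0 = ZPhi.val ⟨-4, 4⟩ :=
  ⟨dist_limit_eq (by decide +kernel), dist_limit_eq (by decide +kernel),
    dist_limit_eq (by decide +kernel), dist_limit_eq (by decide +kernel),
    dist_limit_eq (by decide +kernel)⟩

theorem len_one_two_zero : len 1 2 0 = 2 := by
  have := dist_limit_eq (p := pt 1) (q := pt 2) (l := ⟨2, 0⟩) (by decide +kernel)
  rw [len, this]; simp

theorem potential_zero (k : ℕ) : potential k 0 = (potentialLimit k).val / 50 := by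
  obtain ⟨h1, h2, h3, h4, h5⟩ := path_len_zero
  unfold potential
  split
  all_goals simp [h1, h2, h3, h4, h5, potentialLimit, potentialList]
  all_goals ring

theorem potential_two_zero : potential 2 0 = 2 * ((11 * √5 - 17) / 2) := by
  rw [potential_zero]
  simp [potentialLimit, potentialList, Real.goldenRatio]
  ring

theorem mem_indices {k : ℕ} : k ∈ indices ↔ k ∈ Finset.Icc 1 31 := by
  simp [indices, List.mem_range'_1]; omega

theorem onPath_potential {a b : ℕ} (h : onPath a b = true) (ε : ℝ) :
    potential b ε - potential a ε = len a b ε := by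
  simp only [onPath, List.any_cons, List.any_nil, Bool.or_eq_true, Bool.and_eq_true,
    beq_iff_eq, Bool.or_false] at h
  rcases h with ⟨rfl, rfl⟩ | ⟨rfl, rfl⟩ | ⟨rfl, rfl⟩ | ⟨rfl, rfl⟩ | ⟨rfl, rfl⟩ <;>
    simp [potential]

/-! ### The point sets -/

/-- The point set of the construction at `ε`. -/
noncomputable def points (ε : ℝ) : Finset Plane :=
  (Finset.Icc 1 31).image fun k => (pt k).eval ε

theorem pt_mem_points {k : ℕ} (hk : k ∈ Finset.Icc 1 31) (ε : ℝ) : (pt k).eval ε ∈ points ε :=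
  Finset.mem_image_of_mem _ hk

/-- The `k`-th point, as a member of the point set; `v₁` if there is no such point. -/
noncomputable def vertex (ε : ℝ) (k : ℕ) : points ε :=
  if hk : k ∈ Finset.Icc 1 31 then ⟨(pt k).eval ε, pt_mem_points hk ε⟩
  else ⟨(pt 1).eval ε, pt_mem_points (by simp) ε⟩

theorem vertex_val {k : ℕ} (hk : k ∈ Finset.Icc 1 31) (ε : ℝ) :
    (vertex ε k : Plane) = (pt k).eval ε := by
  rw [vertex, dif_pos hk]

theorem eventually_generic_points : ∀ᶠ ε in 𝓝[>] 0, ∀ a ∈ Finset.Icc 1 31,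
    ∀ b ∈ Finset.Icc 1 31, a < b → ∀ i : Fin 5,
      cross (cwSide i) ((pt b).eval ε - (pt a).eval ε) ≠ 0 ∧
      inner ℝ (cwSide i) ((pt b).eval ε - (pt a).eval ε) ≠ 0 := by
  rw [Filter.eventually_all_finset]
  intro a ha
  rw [Filter.eventually_all_finset]
  intro b hb
  rw [← mem_indices] at ha hb
  have h := generic_check
  simp only [List.all_eq_true, Bool.or_eq_true, decide_eq_true_eq] at h
  rcases h a ha b hb with h | h
  · exact Eventually.of_forall fun ε hab => absurd h (not_le.2 hab)
  · filter_upwards [eventually_generic h] with ε hε _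
    exact hε

theorem injOn_of_generic {ε : ℝ} (h : ∀ a ∈ Finset.Icc 1 31,
    ∀ b ∈ Finset.Icc 1 31, a < b → ∀ i : Fin 5,
      cross (cwSide i) ((pt b).eval ε - (pt a).eval ε) ≠ 0 ∧
      inner ℝ (cwSide i) ((pt b).eval ε - (pt a).eval ε) ≠ 0) :
    Set.InjOn (fun k => (pt k).eval ε) (Finset.Icc 1 31 : Finset ℕ) := by
  intro a ha b hb hab
  by_contra hne
  have hab : (pt a).eval ε = (pt b).eval ε := hab
  rcases lt_or_gt_of_ne hne with hlt | hlt
  · exact (h a ha b hb hlt 0).2 (by rw [hab]; simp)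
  · exact (h b hb a ha hlt 0).2 (by rw [hab]; simp)

theorem generalPosition_of_generic {ε : ℝ} (h : ∀ a ∈ Finset.Icc 1 31,
    ∀ b ∈ Finset.Icc 1 31, a < b → ∀ i : Fin 5,
      cross (cwSide i) ((pt b).eval ε - (pt a).eval ε) ≠ 0 ∧
      inner ℝ (cwSide i) ((pt b).eval ε - (pt a).eval ε) ≠ 0) :
    GeneralPosition (points ε) := by
  intro p hp q hq hpq i
  obtain ⟨a, ha, rfl⟩ := Finset.mem_image.1 hp
  obtain ⟨b, hb, rfl⟩ := Finset.mem_image.1 hq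
  rcases lt_trichotomy a b with hlt | rfl | hlt
  · exact h a ha b hb hlt i
  · exact absurd rfl hpq
  · have := h b hb a ha hlt i
    have e : (pt b).eval ε - (pt a).eval ε = -((pt a).eval ε - (pt b).eval ε) := by abel
    simp only [e, inner_neg_right, ne_eq, neg_eq_zero]
    refine ⟨fun h0 => this.1 ?_, this.2⟩
    simp only [cross, PiLp.neg_apply] at h0 ⊢
    linarith

theorem eventually_not_closest {a b : ℕ} (h : blocked a b = true) :
    ∀ᶠ ε in 𝓝[>] 0, ∀ i, ¬ IsClosestInCone (points ε) i ((pt a).eval ε) ((pt b).eval ε) := by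
  rw [eventually_all]
  intro i
  simp only [blocked, List.all_eq_true, List.mem_finRange, Bool.or_eq_true, true_imp_iff,
    List.any_eq_true, Bool.and_eq_true] at h
  rcases h i with h | ⟨c, hc, h1, h2⟩
  · filter_upwards [eventually_not_inCone h] with ε hε hcl
    exact hε hcl.2.1
  · filter_upwards [eventually_inCone h1, eventually_lower h2] with ε h1 h2 hcl
    exact absurd (hcl.2.2 _ (pt_mem_points (mem_indices.1 hc) ε) h1) (not_le.2 (h2 _))

theorem eventually_slack {a b : ℕ}
    (h : slack (pt a) (pt b) (potentialLimit a) (potentialLimit b) = true) :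
    ∀ᶠ ε in 𝓝[>] 0, |potential a ε - potential b ε| < len a b ε := by
  have c1 : Continuous fun ε => |potential a ε - potential b ε| :=
    ((continuous_potential a).sub (continuous_potential b)).abs
  refine (c1.continuousAt.eventually_lt (continuous_len a b).continuousAt ?_).filter_mono
    nhdsWithin_le_nhds
  rw [potential_zero, potential_zero]
  exact abs_sub_lt_dist_limit h

/-- On path edges the inequality is an equality for every ε, with no slack for a continuity
argument; this is why `potential` uses the actual lengths there. All other edges have strict slack
in the limit. -/
theorem eventually_lipschitz : ∀ᶠ ε in 𝓝[>] 0, ∀ a ∈ Finset.Icc 1 31,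
    ∀ b ∈ Finset.Icc 1 31,
      (∃ i, IsClosestInCone (points ε) i ((pt a).eval ε) ((pt b).eval ε)) →
      |potential a ε - potential b ε| ≤ len a b ε := by
  rw [Filter.eventually_all_finset]
  intro a ha
  rw [Filter.eventually_all_finset]
  intro b hb
  rw [← mem_indices] at ha hb
  have h := edge_check
  simp only [List.all_eq_true, Bool.or_eq_true, beq_iff_eq] at h
  rcases h a ha b hb with (((h | h) | h) | h) | h
  · subst h
    exact Eventually.of_forall fun ε _ => by simpa using len_nonneg a a ε
  · refine Eventually.of_forall fun ε _ => ?_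
    rw [abs_sub_comm, onPath_potential h, abs_of_nonneg (len_nonneg _ _ ε)]
  · refine Eventually.of_forall fun ε _ => ?_
    rw [onPath_potential h, len_comm, abs_of_nonneg (len_nonneg _ _ ε)]
  · filter_upwards [eventually_slack h] with ε hε _
    exact hε.le
  · filter_upwards [eventually_not_closest h] with ε hε ⟨i, hi⟩
    exact absurd hi (hε i)

theorem eventually_closest {i : Fin 5} {a b : ℕ} (hb : b ∈ Finset.Icc 1 31)
    (h : closest i a b = true) :
    ∀ᶠ ε in 𝓝[>] 0, IsClosestInCone (points ε) i ((pt a).eval ε) ((pt b).eval ε) := by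
  simp only [closest, Bool.and_eq_true, List.all_eq_true, Bool.or_eq_true, beq_iff_eq] at h
  have key : ∀ᶠ ε in 𝓝[>] 0, ∀ c ∈ Finset.Icc 1 31,
      InCone i ((pt a).eval ε) ((pt c).eval ε) →
      height i ((pt a).eval ε) ((pt b).eval ε) ≤ height i ((pt a).eval ε) ((pt c).eval ε) := by
    rw [Filter.eventually_all_finset]
    intro c hc
    rcases h.2 c (mem_indices.2 hc) with ((h | h) | h) | h
    · subst h
      -- The apex is not in its own cone, because the second cone inequality is strict.
      refine Eventually.of_forall fun ε hε => absurd hε.2 ?_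
      simp [cross]
    · subst h
      exact Eventually.of_forall fun ε _ => le_rfl
    · filter_upwards [eventually_not_inCone h] with ε hε h1
      exact absurd h1 hε
    · filter_upwards [eventually_lower h] with ε hε _
      exact (hε _).le
  filter_upwards [key, eventually_inCone h.1] with ε h1 h2
  refine ⟨pt_mem_points hb ε, h2, fun p hp hin => ?_⟩
  obtain ⟨c, hc, rfl⟩ := Finset.mem_image.1 hp
  exact h1 c hc hin

/-! ### The placement of the points -/

/-- Cramer's rule: the determinant of the two directions is -sin(2π/5), which cancels the sine in
the determinants that `crossForm` represents. -/
theorem cone_boundaries_meet (p q : GermPoint) (ε : ℝ) :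
    p.eval ε + (1 / 2 * (crossForm 1 (q - p)).eval ε) • cwSide 0
      = q.eval ε + (1 / 2 * (crossForm 0 (q - p)).eval ε) • ccwSide 2 := by
  have h := Real.goldenRatio_sq
  rw [ccwSide_eq, show (2 + 4 : Fin 5) = 1 from rfl, cwSide_eq, cwSide_eq]
  ext j
  fin_cases j
  · simp [crossForm, dirX, dirY]
    linear_combination
      (Real.sin (2 * Real.pi / 5) / 2 * (q.X.eval ε - p.X.eval ε)) * h
  · simp [crossForm, dirX, dirY]
    linear_combination (1 / 2 * (q.Y.eval ε - p.Y.eval ε)) * h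

/-- Decides `InBothTriangles` for small `ε`. -/
def inBothTriangles (i j : Fin 5) (a b x : GermPoint) : Bool :=
  inCone i a b && inCone j b a && inTriangle i a b x && inTriangle j b a x

theorem eventually_inBothTriangles (i j : Fin 5) {a b x : GermPoint}
    (h : inBothTriangles i j a b x = true) :
    ∀ᶠ ε in 𝓝[>] 0, InBothTriangles (a.eval ε) (b.eval ε) (x.eval ε) := by
  simp only [inBothTriangles, Bool.and_eq_true] at h
  filter_upwards [eventually_inCone h.1.1.1, eventually_inCone h.1.1.2,
    eventually_inTriangle h.1.2, eventually_inTriangle h.2] with ε h1 h2 h3 h4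
  exact ⟨i, j, h1, h2, h3, h4⟩

theorem eventually_at_cone_boundaries {a b x p q : GermPoint} (h1 : inCone 0 a b = true)
    (h2 : inCone 2 b a = true)
    (h3 : limitIsShift 0 (⟨2, 0⟩ * (crossForm 1 (b - a)).x₀) a x = true)
    (hpq : p.eval 0 ≠ q.eval 0) {δ : ℝ} (hδ : 0 < δ) :
    ∀ᶠ ε in 𝓝[>] 0, ∃ i j, InCone i (a.eval ε) (b.eval ε) ∧ InCone j (b.eval ε) (a.eval ε) ∧
      ∃ s t : ℝ, 0 ≤ s ∧ 0 ≤ t ∧ a.eval ε + s • cwSide i = b.eval ε + t • ccwSide j ∧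
        dist (x.eval ε) (a.eval ε + s • cwSide i) < δ * dist (p.eval ε) (q.eval ε) := by
  have hc : Continuous fun ε => a.eval ε + (1 / 2 * (crossForm 1 (b - a)).eval ε) • cwSide 0 := by
    have := a.continuous
    fun_prop
  have h0 : x.eval 0 = a.eval 0 + (1 / 2 * (crossForm 1 (b - a)).eval 0) • cwSide 0 := by
    rw [limit_eq_shift h3, Germ.eval_zero]
    congr 2
    simp; ring
  have c1 := h1
  have c2 := h2
  simp only [inCone, Bool.and_eq_true] at c1 c2
  filter_upwards [eventually_inCone h1, eventually_inCone h2, Germ.eventually_pos c1.1,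
    Germ.eventually_pos c2.2, eventually_dist_lt x.continuous hc p.continuous q.continuous h0
      hpq hδ] with ε e1 e2 e3 e4 e5
  -- The index 2 + 4 is 1 in `Fin 5`; membership of `a` in cone 2 of `b` gives the sign of the first
  -- parameter.
  have e4 : 0 < (crossForm 1 (b - a)).eval ε := e4
  exact ⟨0, 2, e1, e2, _, _, by positivity, by positivity, cone_boundaries_meet a b ε, e5⟩

theorem eventually_dist_shift (i : Fin 5) {l : ZPhi} {a x p q : GermPoint}
    (h : limitIsShift i l a x = true) (hpq : p.eval 0 ≠ q.eval 0) {δ : ℝ} (hδ : 0 < δ) :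
    ∀ᶠ ε in 𝓝[>] 0,
      dist (x.eval ε) (a.eval ε + (l.val / 4) • cwSide i) < δ * dist (p.eval ε) (q.eval ε) := by
  have hc : Continuous fun ε => a.eval ε + (l.val / 4) • cwSide i := by
    have := a.continuous
    fun_prop
  exact eventually_dist_lt x.continuous hc p.continuous q.continuous (limit_eq_shift h) hpq hδ

theorem pt_one_ne_pt_two : (pt 1).eval 0 ≠ (pt 2).eval 0 := by
  rw [← dist_pos]
  have := len_one_two_zero
  rw [len] at this
  rw [this]; norm_num

theorem eventually_construction {δ : ℝ} (hδ : 0 < δ) : ∀ᶠ ε in 𝓝[>] 0,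
    Construction (δ * len 1 2 ε) (fun k => (pt k).eval ε) := by
  have h12 := pt_one_ne_pt_two
  have w (i : Fin 5) (a b x : ℕ) (h : nearCw i (pt a) (pt b) (pt x) = true) :=
    eventually_nearCw i h h12 hδ
  have c (i : Fin 5) (a b x : ℕ) (h : nearCcw i (pt a) (pt b) (pt x) = true) :=
    eventually_nearCcw i h h12 hδ
  have s2 := eventually_inCone (i := 0) (p := pt 1) (q := pt 2) (by decide +kernel)
  have s2' := eventually_dist_lt (pt 2).continuous (continuous_cwCorner 0 (pt 1) (pt 2))
    (pt 1).continuous (pt 2).continuous (cwCorner_limit (by decide +kernel)) h12 hδ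
  have s11 := eventually_inBothTriangles 0 2 (a := pt 2) (b := pt 8) (x := pt 19)
    (by decide +kernel)
  have s11' := eventually_at_cone_boundaries (a := pt 2) (b := pt 8) (x := pt 19)
    (by decide +kernel) (by decide +kernel) (by decide +kernel) h12 hδ
  have s14 := eventually_inBothTriangles 4 1 (a := pt 1) (b := pt 10) (x := pt 23)
    (by decide +kernel)
  -- A quarter of 16φ - 24 is the limit 4φ - 6 of |v₁₀v₂₃|; direction 0 is `ccwSide 1`.
  have s14a := eventually_dist_shift 0 (l := ⟨-24, 16⟩) (a := pt 10) (x := pt 23)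
    (by decide +kernel) h12 hδ
  have s14b := eventually_inCone (i := 1) (p := pt 23) (q := pt 1) (by decide +kernel)
  -- A quarter of 8φ - 8 is the limit 2φ - 2 of |v₁v₂₃|.
  have s14c := eventually_dist_shift 1 (l := ⟨-8, 8⟩) (a := pt 23) (x := pt 1)
    (by decide +kernel) h12 hδ
  have p1 : 0 ≤ (ZPhi.val ⟨-24, 16⟩) / 4 :=
    div_nonneg (ZPhi.val_pos (by decide +kernel)).le (by norm_num)
  have p2 : 0 ≤ (ZPhi.val ⟨-8, 8⟩) / 4 :=
    div_nonneg (ZPhi.val_pos (by decide +kernel)).le (by norm_num)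
  filter_upwards [s2, s2', s11, s11', s14, s14a, s14b, s14c,
    c 0 1 2 3 (by decide +kernel), c 3 2 1 4 (by decide +kernel),
    w 2 1 4 5 (by decide +kernel), c 4 4 1 6 (by decide +kernel),
    w 4 2 3 7 (by decide +kernel), c 1 3 2 8 (by decide +kernel),
    w 3 1 6 9 (by decide +kernel), c 0 6 1 10 (by decide +kernel),
    c 3 4 5 11 (by decide +kernel), w 1 5 4 12 (by decide +kernel),
    c 4 5 6 13 (by decide +kernel), w 2 6 5 14 (by decide +kernel),
    c 3 5 14 15 (by decide +kernel), w 1 14 5 16 (by decide +kernel),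
    w 3 6 13 17 (by decide +kernel), c 0 13 6 18 (by decide +kernel),
    c 0 3 7 20 (by decide +kernel), w 3 7 3 21 (by decide +kernel),
    c 2 2 12 22 (by decide +kernel),
    c 2 4 12 24 (by decide +kernel), w 0 12 4 25 (by decide +kernel),
    w 2 13 14 26 (by decide +kernel), c 4 14 13 27 (by decide +kernel),
    w 2 9 18 28 (by decide +kernel), c 4 18 9 29 (by decide +kernel),
    c 4 11 16 30 (by decide +kernel), w 2 16 11 31 (by decide +kernel)]
    with ε h2 h2' h11 h11' h14 h14a h14b h14c h3 h4 h5 h6 h7 h8 h9 h10 h11a h12 h13 h14d h15 h16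
      h17 h18 h20 h21 h22 h24 h25 h26 h27 h28 h29 h30 h31
  exact
    { step_2 := ⟨h2, h2'⟩
      step_3 := ⟨h3, h4⟩
      step_4 := ⟨h5, h6⟩
      step_5 := ⟨h7, h8⟩
      step_6 := ⟨h9, h10⟩
      step_7 := ⟨h11a, h12⟩
      step_8 := ⟨h13, h14d⟩
      step_9 := ⟨h15, h16⟩
      step_10 := ⟨h17, h18⟩
      step_11 := ⟨h11, h11'⟩
      step_12 := ⟨h20, h21⟩
      step_13 := h22
      step_14 := ⟨h14, ⟨_, p1, by rw [ccwSide_eq]; exact h14a⟩, h14b, _, p2, h14c⟩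
      step_15 := ⟨h24, h25⟩
      step_16 := ⟨h26, h27⟩
      step_17 := ⟨h28, h29⟩
      step_18 := ⟨h30, h31⟩ }

/-- Only the points with indices from `1` to `31` matter for the construction. -/
theorem Construction.congr {η : ℝ} {v v' : ℕ → Plane} (h : Construction η v)
    (hv : ∀ k ∈ Finset.Icc 1 31, v' k = v k) : Construction η v' := by
  have e (k : ℕ) (hk : k ∈ Finset.Icc 1 31 := by decide) := hv k hk
  obtain ⟨h2, h3, h4, h5, h6, h7, h8, h9, h10, h11, h12, h13, h14, h15, h16, h17, h18⟩ := h
  simp only [← e 1, ← e 2, ← e 3, ← e 4, ← e 5, ← e 6, ← e 7, ← e 8, ← e 9, ← e 10, ← e 11,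
    ← e 12, ← e 13, ← e 14, ← e 15, ← e 16, ← e 17, ← e 18, ← e 19, ← e 20, ← e 21, ← e 22,
    ← e 23, ← e 24, ← e 25, ← e 26, ← e 27, ← e 28, ← e 29, ← e 30, ← e 31]
    at h2 h3 h4 h5 h6 h7 h8 h9 h10 h11 h12 h13 h14 h15 h16 h17 h18
  exact ⟨h2, h3, h4, h5, h6, h7, h8, h9, h10, h11, h12, h13, h14, h15, h16, h17, h18⟩

/-! ### The shortest path -/

theorem adj_of_closest {P : Finset Plane} {a b : P} (hab : a ≠ b) {i : Fin 5}
    (h : IsClosestInCone P i a b) : (thetaGraph P).Adj a b := by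
  rw [thetaGraph, SimpleGraph.fromRel_adj]
  exact ⟨hab, Or.inl ⟨i, h⟩⟩

theorem exists_shortest_path {ε : ℝ}
    (hinj : Set.InjOn (fun k => (pt k).eval ε) (Finset.Icc 1 31 : Finset ℕ))
    (hlip : ∀ a ∈ Finset.Icc 1 31, ∀ b ∈ Finset.Icc 1 31,
      (∃ i, IsClosestInCone (points ε) i ((pt a).eval ε) ((pt b).eval ε)) →
      |potential a ε - potential b ε| ≤ len a b ε)
    (h1 : IsClosestInCone (points ε) 4 ((pt 1).eval ε) ((pt 23).eval ε))
    (h2 : IsClosestInCone (points ε) 1 ((pt 10).eval ε) ((pt 23).eval ε))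
    (h3 : IsClosestInCone (points ε) 0 ((pt 6).eval ε) ((pt 10).eval ε))
    (h4 : IsClosestInCone (points ε) 1 ((pt 6).eval ε) ((pt 4).eval ε))
    (h5 : IsClosestInCone (points ε) 0 ((pt 4).eval ε) ((pt 2).eval ε)) :
    (∃ w : (thetaGraph (points ε)).Walk (vertex ε 1) (vertex ε 2),
      w.support = [vertex ε 1, vertex ε 23, vertex ε 10, vertex ε 6, vertex ε 4, vertex ε 2] ∧
      walkLength w = graphDist (thetaGraph (points ε)) (vertex ε 1) (vertex ε 2)) ∧
    graphDist (thetaGraph (points ε)) (vertex ε 1) (vertex ε 2)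
      = ENNReal.ofReal (potential 2 ε) := by
  have adj (i : Fin 5) (a b : ℕ) (ha : a ∈ Finset.Icc 1 31) (hb : b ∈ Finset.Icc 1 31)
      (hab : a ≠ b) (h : IsClosestInCone (points ε) i ((pt a).eval ε) ((pt b).eval ε)) :
      (thetaGraph (points ε)).Adj (vertex ε a) (vertex ε b) := by
    refine adj_of_closest (i := i) (fun he => hab (hinj ha hb ?_)) ?_
    · have := congrArg Subtype.val he
      rwa [vertex_val ha, vertex_val hb] at this
    · rwa [vertex_val ha, vertex_val hb]
  have a1 := adj 4 1 23 (by decide) (by decide) (by decide) h1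
  have a2 := (adj 1 10 23 (by decide) (by decide) (by decide) h2).symm
  have a3 := (adj 0 6 10 (by decide) (by decide) (by decide) h3).symm
  have a4 := adj 1 6 4 (by decide) (by decide) (by decide) h4
  have a5 := adj 0 4 2 (by decide) (by decide) (by decide) h5
  have idx : ∀ p : points ε, ∃ k ∈ Finset.Icc 1 31, (pt k).eval ε = p := fun p =>
    Finset.mem_image.1 p.2
  choose k hk hkp using idx
  have kv (j : ℕ) (hj : j ∈ Finset.Icc 1 31) : k (vertex ε j) = j :=
    hinj (hk _) hj (by simpa [vertex_val hj] using hkp (vertex ε j))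
  have lip (a b : points ε) (h : (thetaGraph (points ε)).Adj a b) :
      potential (k b) ε - potential (k a) ε ≤ dist (a : Plane) (b : Plane) := by
    rw [thetaGraph, SimpleGraph.fromRel_adj] at h
    rcases h.2 with h | h
    · have := hlip _ (hk a) _ (hk b) (by rwa [hkp, hkp])
      rw [len, hkp, hkp] at this
      linarith [(abs_le.1 this).1]
    · have := hlip _ (hk b) _ (hk a) (by rwa [hkp, hkp])
      rw [len, hkp, hkp, dist_comm] at this
      linarith [(abs_le.1 this).2]
  let w : (thetaGraph (points ε)).Walk (vertex ε 1) (vertex ε 2) :=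
    .cons a1 (.cons a2 (.cons a3 (.cons a4 (.cons a5 .nil))))
  have hw : walkLength w = ENNReal.ofReal (potential 2 ε) := by
    have e (a b : ℕ) (ha : a ∈ Finset.Icc 1 31) (hb : b ∈ Finset.Icc 1 31) :
        edist (vertex ε a : Plane) (vertex ε b : Plane) = ENNReal.ofReal (len a b ε) := by
      rw [vertex_val ha, vertex_val hb, edist_dist, len]
    have nn (a b : ℕ) := len_nonneg a b ε
    simp only [walkLength, w, SimpleGraph.Walk.darts_cons, SimpleGraph.Walk.darts_nil,
      List.map_cons, List.map_nil, List.sum_cons, List.sum_nil, add_zero]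
    rw [e 1 23 (by decide) (by decide), e 23 10 (by decide) (by decide),
      e 10 6 (by decide) (by decide), e 6 4 (by decide) (by decide),
      e 4 2 (by decide) (by decide), ← ENNReal.ofReal_add (nn _ _) (nn _ _),
      ← ENNReal.ofReal_add (nn _ _) (add_nonneg (nn _ _) (nn _ _)),
      ← ENNReal.ofReal_add (nn _ _) (add_nonneg (nn _ _) (add_nonneg (nn _ _) (nn _ _))),
      ← ENNReal.ofReal_add (nn _ _)
        (add_nonneg (nn _ _) (add_nonneg (nn _ _) (add_nonneg (nn _ _) (nn _ _))))]
    congr 1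
    simp only [potential]
    ring
  have hd : graphDist (thetaGraph (points ε)) (vertex ε 1) (vertex ε 2)
      = ENNReal.ofReal (potential 2 ε) := by
    apply le_antisymm
    · exact hw ▸ iInf_le _ w
    · refine le_iInf fun w' => ?_
      have := le_walkLength (fun p => potential (k p) ε) lip w'
      simp only [kv 1 (by decide), kv 2 (by decide)] at this
      rwa [show potential 1 ε = 0 from rfl, sub_zero] at this
  exact ⟨⟨w, rfl, hw.trans hd.symm⟩, hd⟩

/-! ### Choice of ε and the spanning ratio -/

theorem eventually_potential_bounds {δ : ℝ} (hδ : 0 < δ) : ∀ᶠ ε in 𝓝[>] 0,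
    ((11 * √5 - 17) / 2 - δ) * len 1 2 ε < potential 2 ε ∧
      potential 2 ε < ((11 * √5 - 17) / 2 + δ) * len 1 2 ε := by
  have c := continuous_potential 2
  refine ((Continuous.continuousAt (by fun_prop)).eventually_lt c.continuousAt ?_).and
    (c.continuousAt.eventually_lt (Continuous.continuousAt (by fun_prop)) ?_) |>.filter_mono
      nhdsWithin_le_nhds <;>
  · rw [potential_two_zero, len_one_two_zero]
    linarith

theorem exists_construction (δ : ℝ) (hδ : 0 < δ) :
      ∃ (P : Finset Plane) (v : ℕ → P),
        P.card = 31 ∧ Set.BijOn v (Set.Icc 1 31) Set.univ ∧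
        GeneralPosition P ∧
        Construction (δ * dist (v 1 : Plane) (v 2 : Plane)) (fun k => (v k : Plane)) ∧
        (∃ w : (thetaGraph P).Walk (v 1) (v 2),
          w.support = [v 1, v 23, v 10, v 6, v 4, v 2] ∧
          walkLength w = graphDist (thetaGraph P) (v 1) (v 2)) ∧
        ENNReal.ofReal ((11 * Real.sqrt 5 - 17) / 2 - δ) *
            edist (v 1 : Plane) (v 2 : Plane) ≤ graphDist (thetaGraph P) (v 1) (v 2) ∧
        graphDist (thetaGraph P) (v 1) (v 2) ≤
          ENNReal.ofReal ((11 * Real.sqrt 5 - 17) / 2 + δ) *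
            edist (v 1 : Plane) (v 2 : Plane) := by
  have hc := closest_check
  simp only [Bool.and_eq_true] at hc
  obtain ⟨ε, hgen, hlip, hcons, hb, h1, h2, h3, h4, h5⟩ := (eventually_generic_points.and
    (eventually_lipschitz.and ((eventually_construction hδ).and
    ((eventually_potential_bounds hδ).and
    ((eventually_closest (by decide) hc.1.1.1.1).and
    ((eventually_closest (by decide) hc.1.1.1.2).and
    ((eventually_closest (by decide) hc.1.1.2).and
    ((eventually_closest (by decide) hc.1.2).and
    (eventually_closest (by decide) hc.2))))))))).exists
  have hinj := injOn_of_generic hgen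
  obtain ⟨hw, hd⟩ := exists_shortest_path hinj hlip h1 h2 h3 h4 h5
  have hv (k : ℕ) (hk : k ∈ Finset.Icc 1 31) := vertex_val hk ε
  have hdist : dist (vertex ε 1 : Plane) (vertex ε 2 : Plane) = len 1 2 ε := by
    rw [hv 1 (by decide), hv 2 (by decide), len]
  refine ⟨points ε, vertex ε, ?_, ⟨Set.mapsTo_univ _ _, ?_, ?_⟩, generalPosition_of_generic hgen,
    ?_, hw, ?_, ?_⟩
  · rw [points, Finset.card_image_of_injOn hinj, Nat.card_Icc]
  · intro a ha b hb hab
    rw [← Finset.coe_Icc] at ha hb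
    have := congrArg Subtype.val hab
    rw [hv a ha, hv b hb] at this
    exact hinj ha hb this
  · rintro p -
    obtain ⟨k, hk, hkp⟩ := Finset.mem_image.1 p.2
    refine ⟨k, by simpa using hk, Subtype.ext ?_⟩
    rw [hv k hk, ← hkp]
  · rw [hdist]
    -- `vertex` and `pt` are only known to agree on the indices 1 to 31, since `vertex` defaults to
    -- v₁ elsewhere.
    exact hcons.congr hv
  · rw [hd, edist_dist, hdist, ← ENNReal.ofReal_mul' (len_nonneg 1 2 ε)]
    exact ENNReal.ofReal_le_ofReal hb.1.le
  · rw [hd, edist_dist, hdist, ← ENNReal.ofReal_mul' (len_nonneg 1 2 ε)]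
    exact ENNReal.ofReal_le_ofReal hb.2.le

theorem le_spanningRatio :
    ENNReal.ofReal ((11 * Real.sqrt 5 - 17) / 2) ≤ spanningRatio := by
  refine le_sInf fun t ht => ?_
  rcases eq_or_ne t ⊤ with rfl | htop
  · exact le_top
  refine ENNReal.ofReal_le_of_le_toReal (le_of_forall_pos_le_add fun δ hδ => ?_)
  obtain ⟨P, v, -, hbij, hgp, -, -, hlow, -⟩ := exists_construction δ hδ
  have hne : (v 1 : Plane) ≠ v 2 := fun h => absurd
    (hbij.injOn (by simp) (by simp) (Subtype.ext h)) (by norm_num : (1 : ℕ) ≠ 2)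
  have h := hlow.trans (ht P hgp (v 1) (v 2))
  -- Cancelling |v₁v₂| needs it nonzero, by injectivity of `v`, and finite.
  have h := (ENNReal.mul_le_mul_iff_left (edist_pos.2 hne).ne' (edist_ne_top _ _)).1 h
  have := (ENNReal.ofReal_le_iff_le_toReal htop).1 h
  linarith

end Theta5

theorem mainTheorem2 :
    ENNReal.ofReal ((11 * Real.sqrt 5 - 17) / 2) ≤ Theta5.spanningRatio ∧
    ∀ δ : ℝ, 0 < δ →
      ∃ (P : Finset Theta5.Plane) (v : ℕ → P),
        P.card = 31 ∧ Set.BijOn v (Set.Icc 1 31) Set.univ ∧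
        Theta5.GeneralPosition P ∧
        Theta5.Construction (δ * dist (v 1 : Theta5.Plane) (v 2 : Theta5.Plane))
          (fun k => (v k : Theta5.Plane)) ∧
        (∃ w : (Theta5.thetaGraph P).Walk (v 1) (v 2),
          w.support = [v 1, v 23, v 10, v 6, v 4, v 2] ∧
          Theta5.walkLength w = Theta5.graphDist (Theta5.thetaGraph P) (v 1) (v 2)) ∧
        ENNReal.ofReal ((11 * Real.sqrt 5 - 17) / 2 - δ) *
            edist (v 1 : Theta5.Plane) (v 2 : Theta5.Plane) ≤
          Theta5.graphDist (Theta5.thetaGraph P) (v 1) (v 2) ∧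
        Theta5.graphDist (Theta5.thetaGraph P) (v 1) (v 2) ≤
          ENNReal.ofReal ((11 * Real.sqrt 5 - 17) / 2 + δ) *
            edist (v 1 : Theta5.Plane) (v 2 : Theta5.Plane) :=
  ⟨Theta5.le_spanningRatio, Theta5.exists_construction⟩
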